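/- Call a group $G$ \emph{hyperbolic} if it has a finite generating set $S$ whose word metric $d = d_S$ is Gromov hyperbolic, i.e. there is $\delta$ such that $d(x,y)+d(z,w)\le\max\{d(x,z)+d(y,w),\,d(x,w)+d(y,z)\}+2\delta$ for all $x,y,z,w\in G$. A group has the \emph{finitely generated intersection property} (FGIP) if the intersection of any two of its finitely generated subgroups is finitely generated. Let $G$ be a hyperbolic group and let $N\le G$ be a finitely generated infinite subgroup. Suppose that $tNt^{-1}\subseteq N$ for some $t\in G$ of infinite order with $\langle t\rangle\cap N=\{1_G\}$. Then $G$ does not have the FGIP: there exist finitely generated subgroups $H,K\le G$ such that $H\cap K$ is not finitely generated. -/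

import Mathlib

/-- The word distance on `G` with respect to `S`, that is, the path distance in the Cayley graph,
whose edges join `a` and `a * s` for `s ∈ S` and `a : G`.
It is only used for sets `S` that generate `G`, where the Cayley graph is connected. -/
noncomputable def wordDist {G : Type*} [Group G] (S : Set G) (g h : G) : ℕ :=
  (SimpleGraph.mulCayley S).dist g h

/-- Gromov's four-point condition with constant `δ` for a distance function `d`. -/
def FourPointHyperbolic {X : Type*} (d : X → X → ℕ) (δ : ℝ) : Prop :=
  ∀ x y z w : X,
    (d x y : ℝ) + d z w ≤ max ((d x z : ℝ) + d y w) ((d x w : ℝ) + d y z) + 2 * δ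

/-- A group is (word-, Gromov-) hyperbolic if it has a finite generating set whose word metric
is Gromov hyperbolic. -/
def IsHyperbolicGroup (G : Type*) [Group G] : Prop :=
  ∃ S : Finset G, Subgroup.closure (S : Set G) = ⊤ ∧
    ∃ δ : ℝ, FourPointHyperbolic (wordDist (S : Set G)) δ

/-- The finitely generated intersection property (also called the Howson property). -/
def HasFGIP (G : Type*) [Group G] : Prop :=
  ∀ H K : Subgroup G, H.FG → K.FG → (H ⊓ K).FG

/-- The Cayley graph with respect to a generating set is connected, so that `wordDist` takes no
default values there. -/
theorem mulCayley_connected_of_closure_eq_top {G : Type*} [Group G] {S : Set G}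
    (hS : Subgroup.closure S = ⊤) : (SimpleGraph.mulCayley S).Connected := by
  have step : ∀ g s : G, s ∈ S → (SimpleGraph.mulCayley S).Reachable g (g * s) := by
    intro g s hs
    by_cases h : g = g * s
    · rw [← h]
    · exact SimpleGraph.Adj.reachable
        ((SimpleGraph.mulCayley_adj' S g (g * s)).2 ⟨h, s, hs, Or.inl rfl⟩)
  have key : ∀ a : G, ∀ g : G, (SimpleGraph.mulCayley S).Reachable g (g * a) := by
    intro a
    have ha : a ∈ Subgroup.closure S := by rw [hS]; trivial
    induction ha using Subgroup.closure_induction with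
    | mem s hs => exact fun g => step g s hs
    | one => intro g; rw [mul_one]
    | mul x y _ _ hx hy =>
      intro g
      rw [← mul_assoc]
      exact (hx g).trans (hy _)
    | inv x _ hx =>
      intro g
      have := hx (g * x⁻¹)
      rw [inv_mul_cancel_right] at this
      exact this.symm
  have : Nonempty G := ⟨1⟩
  refine SimpleGraph.Connected.mk ?_
  intro g h
  have := key (g⁻¹ * h) g
  rwa [mul_inv_cancel_left] at this

/-! Suppose some `g ∈ N` and some power `s` of `t` are such that `s` and `g * s * g⁻¹` generate a
free group `F`. Modulo the ascending union of the subgroups `t⁻ᵖ N tᵖ`, both generators equal `s`,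
so an element of `F` lying in `N` has exponent sum zero, because `⟨t⟩` meets `N` trivially. On the
other hand `F ⊓ N` contains all `sʲ (g s g⁻¹ s⁻¹) s⁻ʲ`, `j ≥ 0`. Let the generators act on `ℚ` by `x
/ 2` and `x / 2 + 1`: words of exponent sum zero act by translations, finitely many of them have a
common denominator, yet these conjugates translate by `2⁻ʲ`. Hence `F ⊓ N` is not finitely generated
(`not_hasFGIP_of_free`).

To find `g`, a power of `t` is first shown to translate along a rough geodesic, after a change of
base point (`exists_displacement`, `isAxial`). For each `g`, either ping-pong yields a free group,
or `g tᵖ g⁻¹ = t^q` for some `p > 0` (`exists_free_or_conj_eq`). If the second case held for every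
`g ∈ N`, each `g` would commute with a power of `t` and so lie uniformly near `⟨t⟩`; this is
impossible for an infinite `N` meeting `⟨t⟩` trivially (`exists_mem_free`). -/

/-- A left-invariant pseudometric on a group that satisfies Gromov's four-point condition and
whose balls are finite. -/
structure HyperbolicMetric {G : Type*} [Group G] (d : G → G → ℝ) (δ : ℝ) : Prop where
  self : ∀ x, d x x = 0
  comm : ∀ x y, d x y = d y x
  tri : ∀ x y z, d x z ≤ d x y + d y z
  four : ∀ x y z w, d x y + d z w ≤ max (d x z + d y w) (d x w + d y z) + 2 * δ
  left : ∀ g x y, d (g * x) (g * y) = d x y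
  finite : ∀ r, {x | d 1 x ≤ r}.Finite

/-! ### Word metrics as hyperbolic metrics -/

theorem wordDist_mul_left_le {G : Type*} [Group G] {S : Set G}
    (hS : Subgroup.closure S = ⊤) (g x y : G) : wordDist S (g * x) (g * y) ≤ wordDist S x y := by
  obtain ⟨p, hp⟩ := (mulCayley_connected_of_closure_eq_top hS).exists_walk_length_eq_dist x y
  let φ : SimpleGraph.mulCayley S →g SimpleGraph.mulCayley S :=
    ⟨fun a => g * a, fun h => (SimpleGraph.mulCayley_adj_mul_iff_right).2 h⟩
  have := SimpleGraph.dist_le (p.map φ)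
  rw [SimpleGraph.Walk.length_map, hp] at this
  exact this

theorem wordDist_exists_between {G : Type*} [Group G] {S : Set G}
    (hS : Subgroup.closure S = ⊤) (x y : G) {n : ℕ} (hn : n ≤ wordDist S x y) :
    ∃ m, wordDist S x m = n ∧ wordDist S m y = wordDist S x y - n := by
  have hc := mulCayley_connected_of_closure_eq_top hS
  obtain ⟨p, hp⟩ := hc.exists_walk_length_eq_dist x y
  refine ⟨p.getVert n, ?_⟩
  have h1 := SimpleGraph.dist_le (p.take n)
  have h2 := SimpleGraph.dist_le (p.drop n)
  have h3 := hc.dist_triangle (u := x) (v := p.getVert n) (w := y)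
  rw [SimpleGraph.Walk.take_length] at h1
  rw [SimpleGraph.Walk.drop_length] at h2
  unfold wordDist at *
  omega

theorem finite_wordDist_ball {G : Type*} [Group G] {S : Finset G}
    (hS : Subgroup.closure (S : Set G) = ⊤) (n : ℕ) :
    {x | wordDist (S : Set G) 1 x ≤ n}.Finite := by
  have hc := mulCayley_connected_of_closure_eq_top hS
  induction n with
  | zero =>
    refine (Set.finite_singleton (1 : G)).subset fun x hx => ?_
    have : (SimpleGraph.mulCayley (S : Set G)).dist 1 x = 0 := Nat.le_zero.1 hx
    exact (hc.dist_eq_zero_iff.1 this).symm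
  | succ n ih =>
    have hfin : ({x | wordDist (S : Set G) 1 x ≤ n} ∪
        Set.image2 (· * ·) {x | wordDist (S : Set G) 1 x ≤ n}
          ((S : Set G) ∪ (S : Set G)⁻¹)).Finite :=
      ih.union (ih.image2 _ (S.finite_toSet.union S.finite_toSet.inv))
    refine hfin.subset fun x hx => ?_
    rcases Nat.lt_or_ge n (wordDist (S : Set G) 1 x) with h | h
    · right
      obtain ⟨m, hm1, hm2⟩ := wordDist_exists_between hS 1 x h.le
      have hx' : wordDist (S : Set G) 1 x ≤ n + 1 := hx
      have hadj : (SimpleGraph.mulCayley (S : Set G)).Adj m x := by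
        rw [← SimpleGraph.dist_eq_one_iff_adj]
        change wordDist (S : Set G) m x = 1
        omega
      obtain ⟨-, hs⟩ := (SimpleGraph.mulCayley_adj (s := (S : Set G)) m x).1 hadj
      refine ⟨m, hm1.le, m⁻¹ * x, ?_, by simp⟩
      rcases hs with hs | hs
      · exact Or.inl hs
      · right
        simpa using hs
    · exact Or.inl h

theorem hyperbolicMetric_wordDist {G : Type*} [Group G] {S : Finset G}
    (hS : Subgroup.closure (S : Set G) = ⊤) {δ : ℝ}
    (hδ : FourPointHyperbolic (wordDist (S : Set G)) δ) :
    HyperbolicMetric (fun x y : G => (wordDist (S : Set G) x y : ℝ)) δ where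
  self x := by simp [wordDist]
  comm x y := by simp [wordDist, SimpleGraph.dist_comm]
  tri x y z := by
    exact_mod_cast (mulCayley_connected_of_closure_eq_top hS).dist_triangle
  four := hδ
  left g x y := by
    have h1 := wordDist_mul_left_le hS g x y
    have h2 := wordDist_mul_left_le hS g⁻¹ (g * x) (g * y)
    rw [inv_mul_cancel_left, inv_mul_cancel_left] at h2
    exact_mod_cast le_antisymm h1 h2
  finite r := (finite_wordDist_ball hS ⌊r⌋₊).subset fun x hx => Nat.le_floor hx

/-! ### Four-point estimates and the displacement of powers -/

namespace HyperbolicMetric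

variable {G : Type*} [Group G] {d : G → G → ℝ} {δ : ℝ}

theorem nonneg (h : HyperbolicMetric d δ) (x y : G) : 0 ≤ d x y := by
  have h1 := h.tri x y x
  rw [h.self, h.comm y x] at h1
  linarith

theorem delta_nonneg (h : HyperbolicMetric d δ) : 0 ≤ δ := by
  have h1 := h.four 1 1 1 1
  simp only [h.self, add_zero, max_self, zero_add] at h1
  linarith

theorem four_cases (h : HyperbolicMetric d δ) (x y z w : G) :
    d x y + d z w ≤ d x z + d y w + 2 * δ ∨ d x y + d z w ≤ d x w + d y z + 2 * δ := by
  have := h.four x y z w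
  rcases le_total (d x z + d y w) (d x w + d y z) with h1 | h1
  · right; rwa [max_eq_right h1] at this
  · left; rwa [max_eq_left h1] at this

theorem one_inv_mul (h : HyperbolicMetric d δ) (x y : G) : d 1 (x⁻¹ * y) = d x y := by
  rw [← h.left x, mul_one, mul_inv_cancel_left]

theorem one_inv (h : HyperbolicMetric d δ) (x : G) : d 1 x⁻¹ = d 1 x := by
  rw [h.comm, ← h.left x, mul_one, mul_inv_cancel]

/-- Measuring at another base point. -/
theorem basepoint (h : HyperbolicMetric d δ) (m : G) :
    HyperbolicMetric (fun x y => d (x * m) (y * m)) δ where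
  self x := h.self _
  comm x y := h.comm _ _
  tri x y z := h.tri _ _ _
  four x y z w := h.four _ _ _ _
  left g x y := by simp only [mul_assoc, h.left]
  finite r := by
    have hinj : Function.Injective fun x : G => m⁻¹ * (x * m) := by
      intro x y hxy
      simpa using hxy
    refine ((h.finite r).preimage hinj.injOn).subset fun x hx => ?_
    change d 1 (m⁻¹ * (x * m)) ≤ r
    rw [h.one_inv_mul]
    simpa using hx

/-- A point that lies coarsely between `p'` and `q'`, far from both, also lies coarsely between
points `p` and `q` near `p'` and `q'`, with a constant independent of how near. -/
theorem between_of_near (h : HyperbolicMetric d δ) {p q p' q' z : G} {E r : ℝ}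
    (hE : d p' z + d z q' ≤ d p' q' + E) (hp : d p p' ≤ r) (hq : d q q' ≤ r)
    (hpz : E + r + 2 * δ < d p' z) (hqz : E + r + 4 * δ < d z q') :
    d p z + d z q ≤ d p q + E + 4 * δ := by
  have c1 := h.comm z p
  have c2 := h.comm z p'
  have c3 := h.comm q' q
  have c4 := h.comm q' p
  have c5 := h.comm q' z
  have c6 := h.comm p' p
  have c7 := h.comm q z
  have c8 := h.comm q p
  have n1 := h.nonneg p z
  have n2 := h.nonneg z q
  -- The endpoints are replaced one at a time, at a cost of `2 * δ` each; the other four-point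
  -- alternative would make a distance to `z` negative, by `hpz` and then `hqz`.
  have h1 : d p z + d z q' ≤ d p q' + E + 2 * δ := by
    rcases h.four_cases z p p' q' with h1 | h1 <;> linarith
  rcases h.four_cases z q p q' with h2 | h2 <;> linarith

/-- Two points coarsely between `p` and `q` are about as far apart as their distances from `p`
differ. -/
theorem dist_le_of_between (h : HyperbolicMetric d δ) {p q z w : G} {E : ℝ}
    (hz : d p z + d z q ≤ d p q + E) (hw : d p w + d w q ≤ d p q + E) :
    d z w ≤ |d p z - d p w| + E + 2 * δ := by
  have c1 := h.comm q z
  have c2 := h.comm q w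
  have a1 := le_abs_self (d p z - d p w)
  have a2 := neg_abs_le (d p z - d p w)
  rcases h.four_cases p q z w with h1 | h1 <;> linarith

theorem one_pow_le (h : HyperbolicMetric d δ) (t : G) (n : ℕ) : d 1 (t ^ n) ≤ n * d 1 t := by
  induction n with
  | zero => simp [h.self]
  | succ n ih =>
    have h1 := h.tri 1 (t ^ n) (t ^ (n + 1))
    have h2 := h.left (t ^ n) 1 t
    rw [mul_one, ← pow_succ] at h2
    push_cast
    linarith

theorem unbounded_pow (h : HyperbolicMetric d δ) {t : G} (ht : ¬ IsOfFinOrder t) (r : ℝ) :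
    ∃ n : ℕ, r < d 1 (t ^ n) := by
  by_contra! hc
  have hinj := injective_pow_iff_not_isOfFinOrder.2 ht
  exact Set.infinite_range_of_injective hinj ((h.finite r).subset (Set.range_subset_iff.2 hc))

/-- If translation by `t ^ i` moves the midpoint `m` of a long geodesic from `1` to `t ^ N` far,
then translation by `t ^ (2 * i)` moves it almost twice as far. -/
theorem two_mul_displacement_le (h : HyperbolicMetric d δ) {t m : G} {N i : ℕ} {r : ℝ}
    (hm : d 1 m + d m (t ^ N) = d 1 (t ^ N))
    (hi : d 1 (t ^ i) ≤ r) (hi2 : d 1 (t ^ (2 * i)) ≤ r)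
    (hm1 : 2 * r + 8 * δ < d 1 m) (hm2 : 2 * r + 8 * δ < d m (t ^ N)) :
    2 * d m (t ^ i * m) - 14 * δ ≤ d m (t ^ (2 * i) * m) := by
  have hδ := h.delta_nonneg
  have hr : 0 ≤ r := (h.nonneg _ _).trans hi
  -- As powers of `t` commute, `t ^ j` moves both `1` and `t ^ N` by at most `r`, so the translate
  -- of `m` is still coarsely between them.
  have key : ∀ j : ℕ, d 1 (t ^ j) ≤ r →
      d 1 (t ^ j * m) + d (t ^ j * m) (t ^ N) ≤ d 1 (t ^ N) + 4 * δ := by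
    intro j hj
    have e1 : d (t ^ j) (t ^ j * m) = d 1 m := by
      have := h.left (t ^ j) 1 m
      rwa [mul_one] at this
    have e2 : d (t ^ j * m) (t ^ j * t ^ N) = d m (t ^ N) := h.left _ _ _
    have e3 : d (t ^ j) (t ^ j * t ^ N) = d 1 (t ^ N) := by
      have := h.left (t ^ j) 1 (t ^ N)
      rwa [mul_one] at this
    have e4 : d (t ^ N) (t ^ j * t ^ N) = d 1 (t ^ j) := by
      have := h.left (t ^ N) 1 (t ^ j)
      rwa [mul_one, ← pow_add, add_comm, pow_add] at this
    have := h.between_of_near (p := 1) (q := t ^ N) (p' := t ^ j) (q' := t ^ j * t ^ N)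
      (z := t ^ j * m) (E := 0) (r := r) (by linarith) hj (by linarith) (by linarith)
      (by linarith)
    linarith
  have k0 : d 1 m + d m (t ^ N) ≤ d 1 (t ^ N) + 4 * δ := by linarith
  have k1 := h.dist_le_of_between k0 (key i hi)
  have e0 : d (t ^ i) (t ^ i * m) = d 1 m := by
    have := h.left (t ^ i) 1 m
    rwa [mul_one] at this
  have e1 : d (t ^ i) (t ^ (2 * i) * m) = d 1 (t ^ i * m) := by
    have := h.left (t ^ i) 1 (t ^ i * m)
    rwa [mul_one, ← mul_assoc, ← pow_add, ← two_mul] at this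
  have e2 : d (t ^ i * m) (t ^ (2 * i) * m) = d m (t ^ i * m) := by
    have := h.left (t ^ i) m (t ^ i * m)
    rwa [← mul_assoc, ← pow_add, ← two_mul] at this
  set P0 := d 1 m
  set P1 := d 1 (t ^ i * m)
  set P2 := d 1 (t ^ (2 * i) * m)
  have c1 := h.comm (t ^ i * m) (t ^ i)
  have c2 := h.comm (t ^ (2 * i) * m) (t ^ i)
  have c3 := h.comm (t ^ (2 * i) * m) (t ^ i * m)
  have t1 : |P0 - P1| ≤ r := by
    have a1 := h.tri 1 (t ^ i) (t ^ i * m)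
    have a2 := h.tri (t ^ i) 1 (t ^ i * m)
    have a3 := h.comm (t ^ i) 1
    rw [abs_le]
    constructor <;> linarith
  have t3 := abs_le.1 t1
  have t2 : P0 - r ≤ P2 := by
    have a2 := h.tri (t ^ i) 1 (t ^ (2 * i) * m)
    have a3 := h.comm (t ^ i) 1
    have a4 := h.tri (t ^ (2 * i)) 1 (t ^ (2 * i) * m)
    have a5 := h.left (t ^ (2 * i)) 1 m
    rw [mul_one] at a5
    have a6 := h.comm (t ^ (2 * i)) 1
    linarith
  -- `P0, P1, P2` is nearly an arithmetic progression: the other pairing is at most `2 * r + 8 * δ`,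
  -- too small since `m` is far from `1`. With `k1` this gives the loss `2 * 6 * δ + 2 * δ = 14 *
  -- δ`.
  have f1 : P2 + P0 ≤ 2 * P1 + 2 * δ := by
    rcases h.four_cases 1 (t ^ (2 * i) * m) (t ^ i) (t ^ i * m) with h1 | h1 <;> linarith
  have f2 : 2 * P1 ≤ P2 + P0 + 2 * δ := by
    rcases h.four_cases 1 (t ^ i * m) (t ^ i) (t ^ (2 * i) * m) with h1 | h1 <;> linarith
  have g1 := h.tri 1 m (t ^ (2 * i) * m)
  have g2 := h.tri 1 (t ^ (2 * i) * m) m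
  have g3 := h.comm (t ^ (2 * i) * m) m
  rcases abs_cases (P0 - P1) with ⟨h1, -⟩ | ⟨h1, -⟩ <;> linarith

/-- Some power of an element of infinite order moves some point in a definite direction. -/
theorem exists_displacement (h : HyperbolicMetric d δ)
    (hmid : ∀ (x y : G) (r : ℝ), 0 ≤ r → r ≤ d x y →
      ∃ m, d x m + d m y = d x y ∧ r - 1 ≤ d x m ∧ d x m ≤ r)
    {t : G} (ht : ¬ IsOfFinOrder t) (A : ℝ) :
    ∃ (i : ℕ) (m : G), 0 < i ∧ d m (t ^ i * m) + A ≤ d m (t ^ (2 * i) * m) := by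
  by_contra! hc
  -- If the claim fails, `two_mul_displacement_le` bounds the displacement of a suitable `m` by `A +
  -- 14 * δ` for every `i ≤ B.card`, so two powers of `t` coincide by pigeonhole.
  set B := (h.finite (|A| + 14 * δ)).toFinset with hB
  have hδ := h.delta_nonneg
  have hn := h.nonneg 1 t
  set r : ℝ := (2 * B.card : ℕ) * d 1 t
  have hr : ∀ j ≤ 2 * B.card, d 1 (t ^ j) ≤ r := fun j hj =>
    (h.one_pow_le t j).trans (mul_le_mul_of_nonneg_right (by exact_mod_cast hj) hn)
  have hr0 : 0 ≤ r := (h.nonneg 1 _).trans (hr 0 (Nat.zero_le _))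
  obtain ⟨N, hN⟩ := h.unbounded_pow ht (2 * (2 * r + 8 * δ + 2))
  obtain ⟨m, hm, hm1, hm2⟩ := hmid 1 (t ^ N) (2 * r + 8 * δ + 2) (by linarith) (by linarith)
  have hmem : ∀ i ∈ Finset.range (B.card + 1), m⁻¹ * (t ^ i * m) ∈ B := by
    intro i hi
    rw [Finset.mem_range] at hi
    rw [hB, Set.Finite.mem_toFinset, Set.mem_ofPred_eq, h.one_inv_mul]
    rcases Nat.eq_zero_or_pos i with rfl | hpos
    · rw [pow_zero, one_mul, h.self]
      positivity
    · have h1 := h.two_mul_displacement_le (t := t) (i := i) hm (hr i (by omega))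
        (hr (2 * i) (by omega)) (by linarith) (by linarith)
      have h2 := hc i m hpos
      have := le_abs_self A
      linarith
  obtain ⟨i, -, j, -, hij, he⟩ := Finset.exists_ne_map_eq_of_card_lt_of_maps_to
    (by simp) hmem
  refine hij (injective_pow_iff_not_isOfFinOrder.2 ht ?_)
  simpa using he

end HyperbolicMetric

/-! ### Local-to-global growth and a freeness criterion -/

namespace HyperbolicMetric

variable {G : Type*} [Group G] {d : G → G → ℝ} {δ : ℝ}

/-- A product of elements along which each consecutive pair nearly adds up grows with the number
of factors. -/
theorem prod_cons_ge (h : HyperbolicMetric d δ) {a : ℝ} (ha : 0 < a) :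
    ∀ (l : List G) (u : G),
      (u :: l).IsChain (fun x y => max (d 1 x) (d 1 y) + 2 * δ + a ≤ d 1 (x * y)) →
      (∀ x ∈ u :: l, a ≤ d 1 x) → d 1 l.prod + a ≤ d 1 (u :: l).prod := by
  intro l
  induction l with
  | nil =>
    intro u _ hu
    simpa [h.self] using hu u (by simp)
  | cons v l ih =>
    intro u hch hl
    obtain ⟨huv, hch⟩ := List.isChain_cons_cons.1 hch
    have h1 := ih v hch fun x hx => hl x (List.mem_cons_of_mem _ hx)
    have m1 := le_max_left (d 1 u) (d 1 v)
    have m2 := le_max_right (d 1 u) (d 1 v)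
    simp only [List.prod_cons] at h1 ⊢
    have e1 : d u (u * v) = d 1 v := by simpa using h.left u 1 v
    have e2 : d u (u * (v * l.prod)) = d 1 (v * l.prod) := by
      simpa using h.left u 1 (v * l.prod)
    have e3 : d (u * v) (u * (v * l.prod)) = d 1 l.prod := by
      rw [← mul_assoc]
      simpa using h.left (u * v) 1 l.prod
    have e4 := h.comm (u * v) u
    -- The induction hypothesis `h1` rules out the first alternative; the second is the claim.
    rcases h.four_cases 1 (u * v) u (u * (v * l.prod)) with h2 | h2 <;> linarith

/-- In a nonempty reduced word no letter is followed by its inverse, so `prod_cons_ge` applies to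
its image and keeps it away from `1`. -/
theorem lift_injective (h : HyperbolicMetric d δ) {α : Type*} {f : α → G}
    (hf : ∀ a, 1 ≤ d 1 (f a))
    (hpair : ∀ x y : α × Bool, (x.1 = y.1 → x.2 = y.2) →
      max (d 1 (cond x.2 (f x.1) (f x.1)⁻¹)) (d 1 (cond y.2 (f y.1) (f y.1)⁻¹)) + 2 * δ + 1 ≤
        d 1 (cond x.2 (f x.1) (f x.1)⁻¹ * cond y.2 (f y.1) (f y.1)⁻¹)) :
    Function.Injective (FreeGroup.lift f) := by
  classical
  rw [injective_iff_map_eq_one]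
  intro w hw
  rw [← FreeGroup.toWord_eq_nil_iff]
  have hred : FreeGroup.IsReduced w.toWord := FreeGroup.isReduced_toWord
  rw [← FreeGroup.mk_toWord (x := w), FreeGroup.lift_mk] at hw
  cases hl : w.toWord with
  | nil => rfl
  | cons x l =>
    exfalso
    rw [hl] at hw hred
    rw [List.map_cons] at hw
    have key := h.prod_cons_ge one_pos (l.map fun x => cond x.2 (f x.1) (f x.1)⁻¹)
      (cond x.2 (f x.1) (f x.1)⁻¹) (by
        rw [← List.map_cons (f := fun x : α × Bool => cond x.2 (f x.1) (f x.1)⁻¹),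
          List.isChain_map]
        exact List.IsChain.imp (fun x y hxy => hpair x y hxy) hred) (by
        rw [← List.map_cons (f := fun x : α × Bool => cond x.2 (f x.1) (f x.1)⁻¹)]
        intro y hy
        obtain ⟨⟨b, e⟩, -, rfl⟩ := List.mem_map.1 hy
        cases e
        · simpa [h.one_inv] using hf b
        · simpa using hf b)
    rw [hw, h.self] at key
    have := h.nonneg 1 (l.map fun x => cond x.2 (f x.1) (f x.1)⁻¹).prod
    linarith

theorem dist_pow_pow (h : HyperbolicMetric d δ) (t : G) (i n : ℕ) :
    d (t ^ i) (t ^ (i + n)) = d 1 (t ^ n) := by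
  rw [pow_add]
  simpa using h.left (t ^ i) 1 (t ^ n)

end HyperbolicMetric

/-! ### Axial elements -/

/-- The orbit of `1` under the powers of `t` is a rough geodesic. -/
structure IsAxial {G : Type*} [Group G] (d : G → G → ℝ) (t : G) : Prop where
  step : ∀ n : ℕ, d 1 (t ^ n) + 1 ≤ d 1 (t ^ (n + 1))
  add : ∀ m n : ℕ, d 1 (t ^ m) + d 1 (t ^ n) ≤ d 1 (t ^ (m + n)) + d 1 t

namespace HyperbolicMetric

variable {G : Type*} [Group G] {d : G → G → ℝ} {δ : ℝ}

/-- Of the hypothesis, `2 * δ` is used up by `prod_cons_ge`; the remaining growth of `2 * δ + 1` per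
step absorbs the four-point error in `add`. -/
theorem isAxial (h : HyperbolicMetric d δ) {t : G}
    (ht : d 1 t + (4 * δ + 1) ≤ d 1 (t ^ 2)) : IsAxial d t := by
  have hδ := h.delta_nonneg
  have h2 := h.one_pow_le t 2
  push_cast at h2
  have step : ∀ n : ℕ, d 1 (t ^ n) + (2 * δ + 1) ≤ d 1 (t ^ (n + 1)) := by
    intro n
    have := h.prod_cons_ge (a := 2 * δ + 1) (by linarith) (List.replicate n t) t
      (by
        rw [← List.replicate_succ]
        apply List.isChain_replicate_of_rel
        rw [max_self, ← pow_two]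
        linarith)
      (by
        rw [← List.replicate_succ]
        intro x hx
        rw [List.eq_of_mem_replicate hx]
        linarith)
    rwa [← List.replicate_succ, List.prod_replicate, List.prod_replicate] at this
  refine ⟨fun n => by have := step n; linarith, fun m n => ?_⟩
  cases m with
  | zero =>
    rw [pow_zero, h.self, zero_add, zero_add]
    have := h.nonneg 1 t
    linarith
  | succ k =>
    have s1 := step k
    have s2 := step n
    have e1 : d (t ^ k) (t ^ (k + 1 + n)) = d 1 (t ^ (n + 1)) := by
      rw [← h.dist_pow_pow t k (n + 1)]
      congr 2
      omega
    have e2 := h.dist_pow_pow t (k + 1) n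
    have e3 := h.dist_pow_pow t k 1
    rw [pow_one] at e3
    have c1 := h.comm (t ^ k) 1
    have c2 := h.comm (t ^ (k + 1 + n)) (t ^ (k + 1))
    have c3 := h.comm (t ^ (k + 1 + n)) 1
    rcases h.four_cases (t ^ k) (t ^ (k + 1 + n)) 1 (t ^ (k + 1)) with h1 | h1 <;> linarith

theorem _root_.IsAxial.inv (h : HyperbolicMetric d δ) {t : G} (ht : IsAxial d t) :
    IsAxial d t⁻¹ where
  step n := by simpa only [inv_pow, h.one_inv] using ht.step n
  add m n := by simpa only [inv_pow, h.one_inv] using ht.add m n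

theorem _root_.IsAxial.le (h : HyperbolicMetric d δ) {t : G} (ht : IsAxial d t) (n : ℕ) :
    (n : ℝ) ≤ d 1 (t ^ n) := by
  induction n with
  | zero => simp [h.self]
  | succ n ih =>
    have := ht.step n
    push_cast
    linarith

/-- A discrete intermediate value theorem: consecutive powers differ in length by at most `d 1 t`.
-/
theorem exists_pow_dist_approx (h : HyperbolicMetric d δ) (t : G) {s E : ℝ} (hs : 0 ≤ s)
    (hE : 0 ≤ E) (b : ℕ) (hb : s ≤ d 1 (t ^ b) + E) :
    ∃ c ≤ b, |d 1 (t ^ c) - s| ≤ d 1 t + E := by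
  have hn := h.nonneg 1 t
  induction b with
  | zero =>
    refine ⟨0, le_rfl, ?_⟩
    rw [pow_zero, h.self] at hb ⊢
    rw [abs_le]
    constructor <;> linarith
  | succ b ih =>
    rcases le_or_gt s (d 1 (t ^ b) + E) with h1 | h1
    · obtain ⟨c, hc, h2⟩ := ih h1
      exact ⟨c, hc.trans (Nat.le_succ b), h2⟩
    · refine ⟨b + 1, le_rfl, ?_⟩
      have h3 := h.tri 1 (t ^ b) (t ^ (b + 1))
      rw [h.dist_pow_pow, pow_one] at h3
      rw [abs_le]
      constructor <;> linarith

/-- A point coarsely between `1` and `t ^ b` is near some power of `t`. -/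
theorem near_axis (h : HyperbolicMetric d δ) {t : G} (ht : IsAxial d t) {z : G} {b : ℕ} {E : ℝ}
    (hz : d 1 z + d z (t ^ b) ≤ d 1 (t ^ b) + E) :
    ∃ c : ℕ, d z (t ^ c) ≤ 2 * d 1 t + 2 * E + 2 * δ := by
  have hE : 0 ≤ E := by
    have := h.tri 1 z (t ^ b)
    linarith
  have hn := h.nonneg z (t ^ b)
  have hn1 := h.nonneg 1 t
  obtain ⟨c, hc, h1⟩ := h.exists_pow_dist_approx t (h.nonneg 1 z) hE b (by linarith)
  refine ⟨c, ?_⟩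
  rw [abs_le] at h1
  obtain ⟨e, rfl⟩ := Nat.exists_eq_add_of_le hc
  have h2 := ht.add c e
  have h3 := h.dist_pow_pow t c e
  have c1 := h.comm (t ^ (c + e)) (t ^ c)
  have c2 := h.comm (t ^ (c + e)) z
  rcases h.four_cases 1 (t ^ (c + e)) z (t ^ c) with h4 | h4 <;> linarith

/-- An element that commutes with a positive power of `t` is within a uniform distance of the
powers of `t`. -/
theorem near_axis_of_commute (h : HyperbolicMetric d δ) {t : G} (ht : IsAxial d t) {g : G}
    {p : ℕ} (hp : 0 < p) (hg : Commute g (t ^ p)) :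
    ∃ c : ℤ, d g (t ^ c) ≤ 4 * d 1 t + 10 * δ := by
  have hδ := h.delta_nonneg
  obtain ⟨n, hn⟩ := exists_nat_gt (d 1 t + d 1 g + 4 * δ)
  have hlarge : d 1 t + d 1 g + 4 * δ < d 1 (t ^ (p * n)) := by
    refine hn.trans_le (le_trans ?_ (ht.le h (p * n)))
    exact_mod_cast Nat.le_mul_of_pos_left n hp
  set b := p * n
  have hcomm : Commute g (t ^ b) := by
    rw [pow_mul]
    exact hg.pow_right n
  have e1 : d g (t ^ b * g) = d 1 (t ^ b) := by
    rw [← hcomm.eq]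
    simpa using h.left g 1 (t ^ b)
  have e2 : d (t ^ b * g) (t ^ (b + b) * g) = d 1 (t ^ b) := by
    rw [pow_add, mul_assoc, h.left, e1]
  have e3 : d g (t ^ (b + b) * g) = d 1 (t ^ (b + b)) := by
    rw [pow_add, mul_assoc, ← hcomm.eq, ← mul_assoc, ← hcomm.eq, mul_assoc]
    simpa using h.left g 1 (t ^ b * t ^ b)
  have e4 : d (t ^ (b + b)) (t ^ (b + b) * g) = d 1 g := by
    simpa using h.left (t ^ (b + b)) 1 g
  -- On the translated axis `g * t ^ n`, the point `t ^ b * g = g * t ^ b` is so far from both ends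
  -- that its betweenness constant no longer depends on `g`. It is near the axis, and `t ^ (-b)`
  -- carries this back to `g`.
  have key := h.between_of_near (p := 1) (q := t ^ (b + b)) (p' := g)
    (q' := t ^ (b + b) * g) (z := t ^ b * g) (E := d 1 t) (r := d 1 g)
    (by have := ht.add b b; linarith) le_rfl e4.le (by linarith) (by linarith)
  obtain ⟨c, hc⟩ := h.near_axis ht (E := d 1 t + 4 * δ) (by linarith)
  refine ⟨-(b : ℤ) + c, ?_⟩
  rw [← h.left (t ^ b), zpow_add, zpow_neg, zpow_natCast, zpow_natCast, mul_inv_cancel_left]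
  linarith

/-- If the two powers fail to diverge for arbitrarily large `k`, the ray `g * v ^ n` stays in a
bounded neighbourhood of the powers of `u`. Balls are finite, so two values of `n` give the same
offset from the axis, which yields the conjugacy relation. -/
theorem le_dist_conj_or_conj_eq (h : HyperbolicMetric d δ) {u v : G} (hu : IsAxial d u)
    (hv : IsAxial d v) (huv : ∀ n : ℕ, d 1 (u ^ n) = d 1 (v ^ n)) (g : G) :
    (∀ᶠ k : ℕ in Filter.atTop, max (d 1 (u ^ k)) (d 1 (g * v ^ k * g⁻¹)) + 2 * δ + 1 ≤
      d (u ^ k) (g * v ^ k * g⁻¹)) ∨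
    ∃ (p : ℕ) (q : ℤ), 0 < p ∧ g * v ^ p * g⁻¹ = u ^ q := by
  rw [or_iff_not_imp_left, Filter.not_eventually, Filter.frequently_atTop]
  intro hfreq
  have hδ := h.delta_nonneg
  set c := d 1 g with hc
  have hc0 : 0 ≤ c := h.nonneg _ _
  have hright : ∀ x y, d x (y * g⁻¹) ≤ d x y + c ∧ d x y ≤ d x (y * g⁻¹) + c := by
    intro x y
    have h1 := h.tri x y (y * g⁻¹)
    have h2 := h.tri x (y * g⁻¹) y
    have h3 : d y (y * g⁻¹) = c := by
      have := h.left y 1 g⁻¹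
      rwa [mul_one, h.one_inv] at this
    have h4 := h.comm (y * g⁻¹) y
    constructor <;> linarith
  have hleft : ∀ x, d 1 (g * x) ≤ d 1 x + c ∧ d 1 x ≤ d 1 (g * x) + c := by
    intro x
    have h1 := h.tri 1 g (g * x)
    have h2 := h.tri g 1 (g * x)
    have h3 : d g (g * x) = d 1 x := by simpa using h.left g 1 x
    have h4 := h.comm g 1
    constructor <;> linarith
  have hnear : ∀ n : ℕ, ∃ m : ℕ,
      d (g * v ^ n) (u ^ m) ≤ 2 * d 1 u + 2 * (d 1 u + 2 * c + 2 * δ) + 2 * δ := by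
    intro n
    -- Beyond this bound the first four-point alternative at the end is impossible; the second says
    -- that `g * v ^ n` is coarsely between `1` and `u ^ k`.
    obtain ⟨k0, hk0⟩ := exists_nat_gt (2 * d 1 (v ^ n) + 6 * c + 4 * δ + 1)
    obtain ⟨k, hk, hbig⟩ := hfreq (max n k0)
    rw [not_le] at hbig
    have hnk : n ≤ k := (le_max_left _ _).trans hk
    have hkl : 2 * d 1 (v ^ n) + 6 * c + 4 * δ + 1 < d 1 (v ^ k) :=
      (hk0.trans_le (by exact_mod_cast (le_max_right _ _).trans hk)).trans_le (hv.le h k)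
    refine h.near_axis hu (b := k) ?_
    obtain ⟨e, rfl⟩ := Nat.exists_eq_add_of_le hnk
    have hmax : max (d 1 (u ^ (n + e))) (d 1 (g * v ^ (n + e) * g⁻¹)) ≤
        d 1 (v ^ (n + e)) + 2 * c := by
      refine max_le ?_ ?_
      · rw [huv]
        linarith
      · have h1 := (hright 1 (g * v ^ (n + e))).1
        have h2 := (hleft (v ^ (n + e))).1
        linarith
    have h1 := (hright (u ^ (n + e)) (g * v ^ (n + e))).2
    have h2 := hleft (v ^ (n + e))
    have h3 := hleft (v ^ n)
    have h4 : d (g * v ^ n) (g * v ^ (n + e)) = d 1 (v ^ e) := by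
      rw [h.left, h.dist_pow_pow]
    have h5 := hv.add n e
    have h6 := h.tri 1 (g * v ^ n) (u ^ (n + e))
    have h7 := huv (n + e)
    have h8 := huv 1
    rw [pow_one, pow_one] at h8
    have c1 := h.comm (g * v ^ n) (u ^ (n + e))
    have c2 := h.comm (g * v ^ (n + e)) 1
    have c3 := h.comm (g * v ^ (n + e)) (g * v ^ n)
    have c4 := h.comm (u ^ (n + e)) 1
    have c5 := h.comm (g * v ^ n) 1
    rcases h.four_cases (u ^ (n + e)) (g * v ^ n) (g * v ^ (n + e)) 1 with h9 | h9 <;> linarith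
  choose m hm using hnear
  obtain ⟨n1, -, n2, -, hne, heq⟩ := Set.infinite_univ.exists_ne_map_eq_of_mapsTo
    (f := fun n => (u ^ m n)⁻¹ * (g * v ^ n))
    (fun n _ => by
      change d 1 ((u ^ m n)⁻¹ * (g * v ^ n)) ≤ _
      rw [h.one_inv_mul, h.comm]
      exact hm n) (h.finite (2 * d 1 u + 2 * (d 1 u + 2 * c + 2 * δ) + 2 * δ))
  have main : ∀ n1 n2 : ℕ, n1 < n2 → (u ^ m n1)⁻¹ * (g * v ^ n1) = (u ^ m n2)⁻¹ * (g * v ^ n2) →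
      ∃ (p : ℕ) (q : ℤ), 0 < p ∧ g * v ^ p * g⁻¹ = u ^ q := by
    intro n1 n2 hlt heq
    refine ⟨n2 - n1, (m n2 : ℤ) - m n1, by omega, ?_⟩
    have e1 : v ^ n2 = v ^ (n2 - n1) * v ^ n1 := by
      rw [← pow_add]
      congr 1
      omega
    rw [e1, inv_mul_eq_iff_eq_mul] at heq
    rw [zpow_sub, zpow_natCast, zpow_natCast]
    have hcm : u ^ m n2 * (u ^ m n1)⁻¹ = (u ^ m n1)⁻¹ * u ^ m n2 :=
      ((Commute.refl u).pow_pow _ _).inv_right.eq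
    rw [hcm, eq_inv_mul_iff_mul_eq]
    have heq' : g * v ^ n1 = u ^ m n1 * (u ^ m n2)⁻¹ * (g * v ^ (n2 - n1)) * v ^ n1 := by
      rw [heq]
      group
    have h3 : g = u ^ m n1 * (u ^ m n2)⁻¹ * (g * v ^ (n2 - n1)) := by
      rw [← mul_assoc] at heq'
      exact mul_right_cancel (heq'.trans (by group))
    have hcm' : u ^ m n1 * (u ^ m n2)⁻¹ = (u ^ m n2)⁻¹ * u ^ m n1 :=
      ((Commute.refl u).pow_pow _ _).inv_right.eq
    rw [hcm', mul_assoc, eq_inv_mul_iff_mul_eq] at h3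
    rw [← mul_assoc, ← h3, mul_inv_cancel_right]
  rcases lt_or_gt_of_ne hne with h1 | h1
  · exact main _ _ h1 heq
  · exact main _ _ h1 heq.symm

end HyperbolicMetric

/-! ### Ping-pong and a free pair from `N` -/

theorem Subgroup.pow_conj_mem {G : Type*} [Group G] {N : Subgroup G} {t : G}
    (hconj : ∀ n ∈ N, t * n * t⁻¹ ∈ N) (p : ℕ) : ∀ n ∈ N, t ^ p * n * (t ^ p)⁻¹ ∈ N := by
  induction p with
  | zero => intro n hn; simpa using hn
  | succ p ih =>
    intro n hn
    have := hconj _ (ih n hn)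
    rw [pow_succ', mul_inv_rev]
    simpa only [mul_assoc] using this

namespace HyperbolicMetric

variable {G : Type*} [Group G] {d : G → G → ℝ} {δ : ℝ}

/-- Ping-pong: if large powers of `t` and of its conjugate by `g` diverge in all directions, then
some positive power of `t` and its conjugate by `g` generate a free group. -/
theorem exists_free_of_eventually (h : HyperbolicMetric d δ) {t : G} (ht : IsAxial d t) (g : G)
    (hev : ∀ e₁ e₂ : Bool, ∀ᶠ k : ℕ in Filter.atTop,
      max (d 1 ((cond e₁ t t⁻¹) ^ k)) (d 1 (g * (cond e₂ t t⁻¹) ^ k * g⁻¹)) + 2 * δ + 1 ≤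
        d ((cond e₁ t t⁻¹) ^ k) (g * (cond e₂ t t⁻¹) ^ k * g⁻¹)) :
    ∃ k : ℕ, 0 < k ∧
      Function.Injective (FreeGroup.lift fun b : Bool => cond b (g * t ^ k * g⁻¹) (t ^ k)) := by
  have hδ := h.delta_nonneg
  have hc0 := h.nonneg 1 g
  have hn := h.nonneg 1 t
  -- Conjugation by `g` changes lengths by at most `2 * d 1 g`; this happens twice when the
  -- conjugated letter is repeated, whence `4 * d 1 g`. Pairs of distinct letters are handled by
  -- `hev`.
  obtain ⟨k0, hk0⟩ := exists_nat_gt (d 1 t + 4 * d 1 g + 2 * δ + 1)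
  obtain ⟨k, hk, hkk⟩ := ((Filter.eventually_all.2 fun e₁ => Filter.eventually_all.2 (hev e₁)).and
    (Filter.eventually_ge_atTop k0)).exists
  have hkl : d 1 t + 4 * d 1 g + 2 * δ + 1 < d 1 (t ^ k) :=
    (hk0.trans_le (by exact_mod_cast hkk)).trans_le (ht.le h k)
  have hconj : ∀ x, d 1 (g * x * g⁻¹) ≤ d 1 x + 2 * d 1 g ∧
      d 1 x ≤ d 1 (g * x * g⁻¹) + 2 * d 1 g := by
    intro x
    have h1 := h.tri 1 g (g * x * g⁻¹)
    have h2 := h.tri g (g * x) (g * x * g⁻¹)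
    have h3 := h.tri g 1 (g * x)
    have h4 : d (g * x) (g * x * g⁻¹) = d 1 g := by
      have := h.left (g * x) 1 g⁻¹
      rwa [mul_one, h.one_inv] at this
    have h5 : d g (g * x) = d 1 x := by simpa using h.left g 1 x
    have h6 := h.tri 1 (g * x * g⁻¹) (g * x)
    have h7 := h.comm g 1
    have h8 := h.comm (g * x) (g * x * g⁻¹)
    constructor <;> linarith
  have hlen : ∀ (e : Bool) (n : ℕ), d 1 ((cond e t t⁻¹) ^ n) = d 1 (t ^ n) := by
    rintro (_ | _) n
    · simp only [cond_false, inv_pow, h.one_inv]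
    · rfl
  have hsq : d 1 (t ^ k) + d 1 (t ^ k) ≤ d 1 (t ^ (k + k)) + d 1 t := ht.add k k
  have hX : ∀ e : Bool, cond e (t ^ k) (t ^ k)⁻¹ = (cond e t t⁻¹) ^ k := by
    rintro (_ | _) <;> simp
  have hY : ∀ e : Bool, cond e (g * t ^ k * g⁻¹) (g * t ^ k * g⁻¹)⁻¹ =
      g * (cond e t t⁻¹) ^ k * g⁻¹ := by
    rintro (_ | _) <;> simp [mul_assoc]
  have hinv : ∀ e : Bool, ((cond e t t⁻¹) ^ k)⁻¹ = (cond (!e) t t⁻¹) ^ k := by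
    rintro (_ | _) <;> simp
  have hinvY : ∀ e : Bool, (g * (cond e t t⁻¹) ^ k * g⁻¹)⁻¹ =
      g * (cond (!e) t t⁻¹) ^ k * g⁻¹ := by
    rintro (_ | _) <;> simp [mul_assoc]
  have hmul : ∀ x y, d 1 (x * y) = d x⁻¹ y := by
    intro x y
    rw [← h.left x⁻¹ 1 (x * y), mul_one, inv_mul_cancel_left]
  have hlenY : ∀ e : Bool, d 1 (g * (cond e t t⁻¹) ^ k * g⁻¹) = d 1 (g * t ^ k * g⁻¹) := by
    rintro (_ | _)
    · rw [← h.one_inv, hinvY]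
      rfl
    · rfl
  have hk1 : 0 < k := by
    rcases Nat.eq_zero_or_pos k with rfl | hpos
    · rw [pow_zero, h.self] at hkl
      linarith
    · exact hpos
  refine ⟨k, hk1, h.lift_injective ?_ ?_⟩
  · rintro (_ | _)
    · simp only [cond_false]
      linarith
    · simp only [cond_true]
      have := (hconj (t ^ k)).2
      linarith
  · rintro ⟨_ | _, e₁⟩ ⟨_ | _, e₂⟩ he
    · obtain rfl : e₁ = e₂ := he rfl
      simp only [cond_false, hX]
      rw [max_self, ← pow_add, hlen, hlen]
      linarith
    · simp only [cond_false, cond_true, hX, hY]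
      have := hk (!e₁) e₂
      rw [hmul (cond e₁ t t⁻¹ ^ k), hinv]
      rwa [hlen] at this ⊢
    · simp only [cond_false, cond_true, hX, hY]
      have := hk e₂ (!e₁)
      rw [hmul (g * cond e₁ t t⁻¹ ^ k * g⁻¹), hinvY, max_comm, h.comm (g * _ * _)]
      rwa [hlenY] at this ⊢
    · obtain rfl : e₁ = e₂ := he rfl
      simp only [cond_true, hY]
      have e3 : g * cond e₁ t t⁻¹ ^ k * g⁻¹ * (g * cond e₁ t t⁻¹ ^ k * g⁻¹) =
          g * cond e₁ t t⁻¹ ^ (k + k) * g⁻¹ := by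
        rw [pow_add]
        group
      rw [max_self, e3]
      have h1 := (hconj (cond e₁ t t⁻¹ ^ k)).1
      have h2 := (hconj (cond e₁ t t⁻¹ ^ (k + k))).2
      rw [hlen] at h1 h2
      linarith

theorem exists_free_or_conj_eq (h : HyperbolicMetric d δ) {t : G} (ht : IsAxial d t) (g : G) :
    (∃ k : ℕ, 0 < k ∧
      Function.Injective (FreeGroup.lift fun b : Bool => cond b (g * t ^ k * g⁻¹) (t ^ k))) ∨
    ∃ (p : ℕ) (q : ℤ), 0 < p ∧ g * t ^ p * g⁻¹ = t ^ q := by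
  rw [or_iff_not_imp_right]
  intro hno
  refine h.exists_free_of_eventually ht g fun e₁ e₂ => ?_
  have hax : ∀ e : Bool, IsAxial d (cond e t t⁻¹) := by
    rintro (_ | _)
    exacts [ht.inv h, ht]
  have hlen : ∀ (e : Bool) (n : ℕ), d 1 ((cond e t t⁻¹) ^ n) = d 1 (t ^ n) := by
    rintro (_ | _) n
    · simp only [cond_false, inv_pow, h.one_inv]
    · rfl
  refine (h.le_dist_conj_or_conj_eq (hax e₁) (hax e₂)
    (fun n => by rw [hlen, hlen]) g).resolve_right ?_
  rintro ⟨p, q, hp, hpq⟩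
  apply hno
  have hz : ∃ q' : ℤ, (cond e₁ t t⁻¹) ^ q = t ^ q' := by
    cases e₁
    · exact ⟨-q, by simp⟩
    · exact ⟨q, rfl⟩
  obtain ⟨q', hq'⟩ := hz
  rw [hq'] at hpq
  cases e₂
  · refine ⟨p, -q', hp, ?_⟩
    rw [zpow_neg, ← hpq]
    simp [mul_assoc]
  · exact ⟨p, q', hp, hpq⟩

/-- An infinite subgroup that is conjugated into itself by `t` and meets `⟨t⟩` trivially contains
an element `g` such that a power of `t` and its conjugate by `g` generate a free group. -/
theorem exists_mem_free (h : HyperbolicMetric d δ) {t : G} (ht : IsAxial d t) (N : Subgroup G)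
    [Infinite N] (hconj : ∀ n ∈ N, t * n * t⁻¹ ∈ N) (htriv : Subgroup.zpowers t ⊓ N = ⊥) :
    ∃ g ∈ N, ∃ k : ℕ, 0 < k ∧
      Function.Injective (FreeGroup.lift fun b : Bool => cond b (g * t ^ k * g⁻¹) (t ^ k)) := by
  by_contra! hno
  have hconj_pow := Subgroup.pow_conj_mem hconj
  have htriv' : ∀ q : ℤ, t ^ q ∈ N → t ^ q = 1 := fun q hq => by
    have : t ^ q ∈ Subgroup.zpowers t ⊓ N := ⟨⟨q, rfl⟩, hq⟩
    rwa [htriv, Subgroup.mem_bot] at this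
  have hnear : ∀ g : N, ∃ c : ℤ, d (g : G) (t ^ c) ≤ 4 * d 1 t + 10 * δ := by
    rintro ⟨g, hg⟩
    obtain ⟨p, q, hp, hpq⟩ := (h.exists_free_or_conj_eq ht g).resolve_left
      fun ⟨k, hk, hinj⟩ => hno g hg k hk hinj
    refine h.near_axis_of_commute ht hp ?_
    -- This element equals `t ^ (q - p)`, so it is trivial and `g` commutes with `t ^ p`.
    have hmem : g * (t ^ p * g⁻¹ * (t ^ p)⁻¹) ∈ N :=
      N.mul_mem hg (hconj_pow p _ (N.inv_mem hg))
    rw [← mul_assoc, ← mul_assoc, hpq, ← zpow_natCast, ← zpow_neg, ← zpow_add] at hmem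
    have h1 := htriv' _ hmem
    rw [zpow_add, zpow_neg, mul_inv_eq_one, zpow_natCast] at h1
    rw [h1, mul_inv_eq_iff_eq_mul] at hpq
    exact hpq
  choose c hc using hnear
  obtain ⟨x, -, y, -, hne, heq⟩ := (Set.infinite_univ (α := N)).exists_ne_map_eq_of_mapsTo
    (f := fun g : N => (t ^ c g)⁻¹ * (g : G))
    (fun g _ => by
      change d 1 ((t ^ c g)⁻¹ * (g : G)) ≤ _
      rw [h.one_inv_mul, h.comm]
      exact hc g) (h.finite (4 * d 1 t + 10 * δ))
  have e1 : t ^ (c x - c y) = (x : G) * (y : G)⁻¹ := by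
    rw [sub_eq_neg_add, zpow_add, zpow_neg] at *
    rw [inv_mul_eq_iff_eq_mul] at heq
    rw [heq, mul_assoc, mul_assoc, mul_inv_cancel, mul_one, ← zpow_neg, ← zpow_add,
      ← zpow_add, add_comm]
  have h1 := htriv' (c x - c y) (e1 ▸ N.mul_mem x.2 (N.inv_mem y.2))
  rw [e1, mul_inv_eq_one] at h1
  exact hne (Subtype.ext h1)

end HyperbolicMetric

/-! ### Exponent sums and a dyadic affine action -/

namespace FreeGroup

/-- The action of the free group of rank two on `ℚ` by `x ↦ x / 2` and `x ↦ x / 2 + 1`. -/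
def dyadicAction : FreeGroup Bool →* Equiv.Perm ℚ :=
  lift fun b => cond b ((Equiv.mulLeft₀ (1 / 2 : ℚ) (by norm_num)).trans (Equiv.addRight 1))
    (Equiv.mulLeft₀ (1 / 2 : ℚ) (by norm_num))

/-- The exponent sum of a word in two letters. -/
def exponentSum : FreeGroup Bool →* Multiplicative ℤ :=
  lift fun _ => Multiplicative.ofAdd 1

theorem dyadicAction_of_false (x : ℚ) : dyadicAction (of false) x = 1 / 2 * x := by
  simp [dyadicAction]

theorem dyadicAction_of_true (x : ℚ) : dyadicAction (of true) x = 1 / 2 * x + 1 := by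
  simp [dyadicAction]

theorem dyadicAction_apply_inv (w : FreeGroup Bool) (x : ℚ) :
    dyadicAction w (dyadicAction w⁻¹ x) = x := by
  rw [← Equiv.Perm.mul_apply, ← _root_.map_mul, mul_inv_cancel, _root_.map_one, Equiv.Perm.one_apply]

/-- Both generators are affine of slope `1 / 2`, so the exponent sum determines the slope; exponent
sum zero means a translation. -/
theorem dyadicAction_apply (w : FreeGroup Bool) (x : ℚ) :
    dyadicAction w x =
      (1 / 2 : ℚ) ^ (Multiplicative.toAdd (exponentSum w)) * x + dyadicAction w 0 := by
  have hof : ∀ (b : Bool) (x : ℚ),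
      dyadicAction (of b) x = 1 / 2 * x + dyadicAction (of b) 0 := by
    rintro (_ | _) x
    · simp [dyadicAction_of_false]
    · simp [dyadicAction_of_true]
  induction w using FreeGroup.induction_on generalizing x with
  | C1 => simp
  | of b =>
    have : exponentSum (of b) = Multiplicative.ofAdd 1 := by simp [exponentSum]
    rw [hof, this]
    simp
  | inv_of b _ =>
    have h1 : exponentSum (of b)⁻¹ = Multiplicative.ofAdd (-1) := by simp [exponentSum]
    have h2 := hof b (dyadicAction (of b)⁻¹ x)
    have h3 := hof b (dyadicAction (of b)⁻¹ 0)
    rw [dyadicAction_apply_inv] at h2 h3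
    rw [h1, toAdd_ofAdd, zpow_neg_one]
    linarith
  | mul v w hv hw =>
    rw [_root_.map_mul, Equiv.Perm.mul_apply, hv, hw, Equiv.Perm.mul_apply, hv (dyadicAction w 0),
      _root_.map_mul, toAdd_mul, zpow_add₀ (by norm_num)]
    ring

theorem dyadicAction_conj (j : ℕ) :
    dyadicAction (of false ^ j * (of true * (of false)⁻¹) * (of false ^ j)⁻¹) 0 =
      (1 / 2 : ℚ) ^ j := by
  have hpow : ∀ (j : ℕ) (x : ℚ), dyadicAction (of false ^ j) x = (1 / 2) ^ j * x := by
    intro j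
    induction j with
    | zero => simp
    | succ j ih =>
      intro x
      rw [pow_succ, _root_.map_mul, Equiv.Perm.mul_apply, dyadicAction_of_false, ih]
      ring
  have hinv : ∀ j : ℕ, dyadicAction (of false ^ j)⁻¹ 0 = 0 := by
    intro j
    rw [_root_.map_inv, Equiv.Perm.inv_eq_iff_eq, hpow, mul_zero]
  have hinv1 := hinv 1
  rw [pow_one] at hinv1
  rw [_root_.map_mul, _root_.map_mul, _root_.map_mul, Equiv.Perm.mul_apply, Equiv.Perm.mul_apply,
    Equiv.Perm.mul_apply, hinv, hinv1, dyadicAction_of_true, hpow]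
  ring

/-- A group of words with exponent sum zero is not finitely generated if it contains the
conjugates of `b a⁻¹` by all nonnegative powers of `a`. -/
theorem not_fg_of_exponentSum {P : Subgroup (FreeGroup Bool)}
    (hker : ∀ w ∈ P, exponentSum w = 1)
    (hmem : ∀ j : ℕ, of false ^ j * (of true * (of false)⁻¹) * (of false ^ j)⁻¹ ∈ P) :
    ¬ P.FG := by
  rintro ⟨S, rfl⟩
  have htrans : ∀ w ∈ Subgroup.closure (S : Set (FreeGroup Bool)), ∀ x,
      dyadicAction w x = x + dyadicAction w 0 := by
    intro w hw x
    rw [dyadicAction_apply, hker w hw]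
    simp
  set D : ℕ := ∏ s ∈ S, (dyadicAction s 0).den with hD
  have hDpos : 0 < D := Finset.prod_pos fun s _ => Rat.den_pos _
  have hint : ∀ w ∈ Subgroup.closure (S : Set (FreeGroup Bool)),
      ∃ n : ℤ, dyadicAction w 0 * D = n := by
    intro w hw
    induction hw using Subgroup.closure_induction with
    | mem s hs =>
      obtain ⟨c, hc⟩ := Finset.dvd_prod_of_mem (fun s => (dyadicAction s 0).den) hs
      refine ⟨(dyadicAction s 0).num * c, ?_⟩
      rw [hD, hc]
      push_cast
      rw [← mul_assoc, Rat.mul_den_eq_num]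
    | one => exact ⟨0, by simp⟩
    | mul v w hv hw ihv ihw =>
      obtain ⟨m, hm⟩ := ihv
      obtain ⟨n, hn⟩ := ihw
      refine ⟨n + m, ?_⟩
      rw [_root_.map_mul, Equiv.Perm.mul_apply, htrans v hv, add_mul, hm, hn]
      push_cast
      ring
    | inv w hw ih =>
      obtain ⟨n, hn⟩ := ih
      refine ⟨-n, ?_⟩
      have h1 := htrans w hw (dyadicAction w⁻¹ 0)
      rw [dyadicAction_apply_inv] at h1
      push_cast
      rw [← hn, ← neg_mul]
      congr 1
      linarith
  -- Taking `j = D` suffices: `D / 2 ^ D` lies strictly between `0` and `1`, so it is no integer.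
  obtain ⟨n, hn⟩ := hint _ (hmem D)
  rw [dyadicAction_conj] at hn
  have hlt : (D : ℚ) < 2 ^ D := by exact_mod_cast Nat.lt_two_pow_self
  have hD0 : (0 : ℚ) < D := by exact_mod_cast hDpos
  have h0 : (0 : ℚ) < n := by rw [← hn]; positivity
  have h1 : (n : ℚ) < 1 := by
    rw [← hn, one_div, inv_pow, inv_mul_lt_iff₀ (by positivity), mul_one]
    exact hlt
  have h0' : 0 < n := by exact_mod_cast h0
  have h1' : n < 1 := by exact_mod_cast h1
  omega

end FreeGroup

/-! ### The intersection with `N` and the conclusion -/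

theorem Subgroup.FG.of_map_injective {F G : Type*} [Group F] [Group G] {f : F →* G}
    (hf : Function.Injective f) {P : Subgroup F} (hP : (P.map f).FG) : P.FG := by
  rw [← Group.fg_iff_subgroup_fg] at hP ⊢
  let e := P.equivMapOfInjective f hf
  exact Group.fg_of_surjective (f := e.symm.toMonoidHom) e.symm.surjective

/-- If `t` conjugates the finitely generated subgroup `N` into itself, meets it trivially, and
`t ^ k` and its conjugate by an element of `N` generate a free group, then this free group and `N`
have an intersection that is not finitely generated. -/
theorem not_hasFGIP_of_free {G : Type*} [Group G] {N : Subgroup G} (hN : N.FG) {t g : G}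
    (ht : ¬ IsOfFinOrder t) (hconj : ∀ n ∈ N, t * n * t⁻¹ ∈ N)
    (htriv : Subgroup.zpowers t ⊓ N = ⊥) (hg : g ∈ N) {k : ℕ} (hk : 0 < k)
    (hfree : Function.Injective
      (FreeGroup.lift fun b : Bool => cond b (g * t ^ k * g⁻¹) (t ^ k))) :
    ¬ HasFGIP G := by
  intro hG
  set f : FreeGroup Bool →* G := FreeGroup.lift fun b : Bool => cond b (g * t ^ k * g⁻¹) (t ^ k)
  have hfalse : f (FreeGroup.of false) = t ^ k := by simp [f]
  have htrue : f (FreeGroup.of true) = g * t ^ k * g⁻¹ := by simp [f]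
  have hconj_pow := Subgroup.pow_conj_mem hconj
  have hfg : (f.range ⊓ N).FG := by
    refine hG _ _ ?_ hN
    rw [← Group.fg_iff_subgroup_fg]
    exact Group.fg_of_surjective f.rangeRestrict_surjective
  rw [← Subgroup.map_comap_eq] at hfg
  refine FreeGroup.not_fg_of_exponentSum (P := N.comap f) ?_ ?_
    (Subgroup.FG.of_map_injective hfree hfg)
  -- `V` is the ascending union of the `t⁻ᵖ N tᵖ`. Unlike `N`, it is stable under conjugation by
  -- negative powers of `t` as well.
  · let V : Subgroup G :=
      { carrier := {x | ∃ p : ℕ, t ^ p * x * (t ^ p)⁻¹ ∈ N}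
        one_mem' := ⟨0, by simp⟩
        mul_mem' := by
          rintro x y ⟨p, hp⟩ ⟨q, hq⟩
          refine ⟨p + q, ?_⟩
          have h1 := hconj_pow q _ hp
          have h2 := hconj_pow p _ hq
          have e1 : t ^ (p + q) * (x * y) * (t ^ (p + q))⁻¹ =
              (t ^ q * (t ^ p * x * (t ^ p)⁻¹) * (t ^ q)⁻¹) *
                (t ^ p * (t ^ q * y * (t ^ q)⁻¹) * (t ^ p)⁻¹) := by
            group
          rw [e1]
          exact N.mul_mem h1 h2
        inv_mem' := by
          rintro x ⟨p, hp⟩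
          refine ⟨p, ?_⟩
          have := N.inv_mem hp
          simpa [mul_assoc] using this }
    have hNV : ∀ x ∈ N, x ∈ V := fun x hx => ⟨0, by simpa using hx⟩
    have hVconj : ∀ (p : ℤ), ∀ x ∈ V, t ^ p * x * (t ^ p)⁻¹ ∈ V := by
      rintro p x ⟨q, hq⟩
      -- The witness is `q` for `p ≥ 0` and `q + |p|` for `p < 0`.
      refine ⟨q + p.natAbs - p.toNat, ?_⟩
      obtain ⟨m, rfl | rfl⟩ := Int.eq_nat_or_neg p
      · have := hconj_pow m _ hq
        have e1 : q + (m : ℤ).natAbs - (m : ℤ).toNat = q := by simp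
        rw [e1]
        have e2 : t ^ q * (t ^ (m : ℤ) * x * (t ^ (m : ℤ))⁻¹) * (t ^ q)⁻¹ =
            t ^ m * (t ^ q * x * (t ^ q)⁻¹) * (t ^ m)⁻¹ := by
          group
        rwa [e2]
      · have e1 : q + (-(m : ℤ)).natAbs - (-(m : ℤ)).toNat = q + m := by simp
        rw [e1]
        have e2 : t ^ (q + m) * (t ^ (-(m : ℤ)) * x * (t ^ (-(m : ℤ)))⁻¹) * (t ^ (q + m))⁻¹ =
            t ^ q * x * (t ^ q)⁻¹ := by
          group
        rwa [e2]
    have hV : ∀ w : FreeGroup Bool,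
        f w * t ^ (-(k * Multiplicative.toAdd (FreeGroup.exponentSum w)) : ℤ) ∈ V := by
      have hof : ∀ b : Bool, f (FreeGroup.of b) * t ^ (-(k : ℤ)) ∈ V := by
        rintro (_ | _)
        · rw [hfalse, zpow_neg, zpow_natCast, mul_inv_cancel]
          exact V.one_mem
        · apply hNV
          rw [htrue, zpow_neg, zpow_natCast]
          have := N.mul_mem hg (hconj_pow k _ (N.inv_mem hg))
          simpa only [mul_assoc] using this
      have hexp : ∀ b : Bool,
          Multiplicative.toAdd (FreeGroup.exponentSum (FreeGroup.of b)) = 1 := by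
        simp [FreeGroup.exponentSum]
      intro w
      induction w using FreeGroup.induction_on with
      | C1 => simp
      | of b => rw [hexp, mul_one]; exact hof b
      | inv_of b _ =>
        have := hVconj (-k) _ (V.inv_mem (hof b))
        rw [map_inv, map_inv, toAdd_inv, hexp]
        simpa using this
      | mul v w hv hw =>
        have := V.mul_mem hv
          (hVconj (k * Multiplicative.toAdd (FreeGroup.exponentSum v)) _ hw)
        rw [map_mul, map_mul, toAdd_mul, mul_add, neg_add_rev, zpow_add]
        rw [zpow_neg t (k * Multiplicative.toAdd (FreeGroup.exponentSum v))] at this ⊢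
        simpa only [mul_assoc, inv_mul_cancel_left] using this
    intro w hw
    have h1 := V.mul_mem (V.inv_mem (hV w)) (hNV _ hw)
    rw [zpow_neg, mul_inv_rev, inv_inv, inv_mul_cancel_right] at h1
    obtain ⟨p, hp⟩ := h1
    -- A power of `t` in `V` already lies in `N`, because `t ^ p` centralises it.
    have e1 : ∀ q : ℤ, t ^ p * t ^ q * (t ^ p)⁻¹ = t ^ q := by
      intro q
      group
    rw [e1] at hp
    have h2 : t ^ (k * Multiplicative.toAdd (FreeGroup.exponentSum w) : ℤ) ∈
        Subgroup.zpowers t ⊓ N := ⟨⟨_, rfl⟩, hp⟩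
    rw [htriv, Subgroup.mem_bot] at h2
    have h3 := injective_zpow_iff_not_isOfFinOrder.2 ht (h2.trans (zpow_zero t).symm)
    rcases mul_eq_zero.1 h3 with h4 | h4
    · omega
    · exact toAdd_eq_zero.1 h4
  · intro j
    rw [Subgroup.mem_comap]
    simp only [map_mul, map_inv, map_pow, hfalse, htrue, ← pow_mul]
    refine hconj_pow _ _ ?_
    have := N.mul_mem hg (hconj_pow k _ (N.inv_mem hg))
    simpa only [mul_assoc] using this

theorem mainTheorem6 {G : Type*} [Group G] (hG : IsHyperbolicGroup G)
    (N : Subgroup G) (hNfg : N.FG) (hNinf : Infinite N)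
    (t : G) (ht : ¬ IsOfFinOrder t)
    (hconj : ∀ n ∈ N, t * n * t⁻¹ ∈ N)
    (htriv : Subgroup.zpowers t ⊓ N = ⊥) :
    ¬ HasFGIP G := by
  obtain ⟨S, hS, δ, hδ⟩ := hG
  have h := hyperbolicMetric_wordDist hS hδ
  obtain ⟨i, m, hi, him⟩ := h.exists_displacement (fun x y r hr hxy => by
    obtain ⟨m, hm1, hm2⟩ := wordDist_exists_between hS x y (n := ⌊r⌋₊)
      (Nat.floor_le_of_le hxy)
    have hle : ⌊r⌋₊ ≤ wordDist (S : Set G) x y := Nat.floor_le_of_le hxy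
    refine ⟨m, ?_, ?_, ?_⟩
    · have : wordDist (S : Set G) x m + wordDist (S : Set G) m y = wordDist (S : Set G) x y := by
        omega
      exact_mod_cast this
    · rw [hm1]
      exact (Nat.sub_one_lt_floor r).le
    · rw [hm1]
      exact Nat.floor_le hr) ht (4 * δ + 1)
  -- Rebasing at `m` turns the displacement estimate for `m` into one for `1`; `4 * δ + 1` is the
  -- gap that `isAxial` needs.
  have hax := (h.basepoint m).isAxial (t := t ^ i)
    (by rw [← pow_mul, mul_comm i 2, one_mul]; exact him)
  have hconj' := Subgroup.pow_conj_mem hconj i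
  have htriv' : Subgroup.zpowers (t ^ i) ⊓ N = ⊥ := by
    rw [eq_bot_iff, ← htriv]
    exact inf_le_inf_right N (Subgroup.zpowers_le.2 (Subgroup.npow_mem_zpowers t i))
  obtain ⟨g, hg, k, hk, hfree⟩ := (h.basepoint m).exists_mem_free hax N hconj' htriv'
  refine not_hasFGIP_of_free hNfg (fun hfin => ht ?_) hconj' htriv' hg hk hfree
  exact (isOfFinOrder_pow.1 hfin).resolve_right hi.ne'
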